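/- Let $k$ be an algebraically closed field of characteristic zero; algebras are unital and associative. Let $R = A * B$ be the free product of $A = k^{\oplus 3}$ and $B = k^{\oplus 3}$, let $p_1,p_2,p_3$ and $q_1,q_2,q_3$ be the primitive idempotents of $A$ and of $B$, and put $\overline{A} = \langle p_1,p_2\rangle$, $\overline{B} = \langle q_1,q_2\rangle$. For a point $x = (x_{11}:x_{12}:x_{21}:x_{22})$ of $\mathbb{P}^3$ over $k$, let $S_x$ be the quotient of $R$ by the two-sided ideal generated by $\sum_{i,j=1}^{2} x_{ij}[p_i,q_j]$. For a $k$-algebra $S$ let $\mathrm{mid}(S) \in \mathbb{N}\cup\{\infty\}$ be the supremum of the $k$-dimensions of the irreducible representations of $S$. Let $Q \subset \mathbb{P}^3$ be the quadric $x_{11}x_{22} = x_{12}x_{21}$. Let $l_1,l_2,l_3 \subset Q$ be the lines $x_{21}=x_{22}=0$; $x_{11}=x_{12}=0$; $x_{11}=x_{21},\ x_{12}=x_{22}$, let $l'_1,l'_2,l'_3 \subset Q$ be the lines $x_{12}=x_{22}=0$; $x_{11}=x_{21}=0$; $x_{11}=x_{12},\ x_{21}=x_{22}$, and let $pt_{ij}$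 be the point $l_i \cap l'_j$, $i,j=1,2,3$. Let $x \in Q$. 0. There is a two-dimensional subspace $V \subset \overline{A}\oplus\overline{B} \subset R$ such that the span $[V,V]$ of the commutators of elements of $V$ is the line $k\cdot\sum_{i,j} x_{ij}[p_i,q_j]$. For every such $V$, with $R(V) \subset R$ the subalgebra generated by $V$, the partial abelianization of $R$ with respect to $R(V)$ (the quotient of $R$ by the two-sided ideal generated by all $[r,s]$, $r,s\in R(V)$) is isomorphic to $S_x$, compatibly with the projections from $R$. 1. If $x = pt_{ij}$, then $S_x$ is the quotient of $R$ by the single relation $[p_i,q_j]=0$, and it is isomorphic to the quotient of $R$ by $[p_{i_0},q_{j_0}]=0$ for arbitrary $i_0,j_0\in\{1,2,3\}$. Moreover $\mathrm{mid}(S_x)=\infty$, and $S_x$ even has finite-dimensional irreducible representations of arbitrarily large dimension. 2. If $x$ lies on one of the six lines $l_i,l'_i$ but is none of the nine points $pt_{ij}$, then: if $x\in l_i$, $S_x$ is the quotient of $R$ by the relations $[p_i,q_1]=[p_i,q_2]=0$; if $x\in l'_j$, $S_x$ is the quotient of $R$ by the relations $[p_1,q_j]=[p_2,q_j]=0$.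 In both cases $S_x$ is isomorphic to the quotient of $R$ by $[p_{i_0},q_1]=[p_{i_0},q_2]=0$ for any $i_0$, and to the quotient of $R$ by $[p_1,q_{j_0}]=[p_2,q_{j_0}]=0$ for any $j_0$. Moreover $\mathrm{mid}(S_x)=\infty$, and $S_x$ even has finite-dimensional irreducible representations of arbitrarily large dimension. 3. If $x\in Q$ lies on none of the six lines, then $S_x\cong k^{\oplus 9}$, and $\mathrm{mid}(S_x)=1$. -/

import Mathlib

open scoped LinearAlgebra.Projectivization

universe u

noncomputable section

namespace PartialAbelianization

section General

variable (k : Type u) [Field k] {R : Type u} [Ring R] [Algebra k R]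

/-- The quotient of the algebra `R` by the two-sided ideal generated by the set `s`. -/
abbrev QuotBy (s : Set R) : Type u := RingQuot (fun a b : R => a ∈ s ∧ b = 0)

/-- The canonical projection onto the quotient. -/
abbrev QuotBy.proj (s : Set R) : R →ₐ[k] QuotBy s :=
  RingQuot.mkAlgHom k (fun a b : R => a ∈ s ∧ b = 0)

/-- The quotients of `R` by `s` and by `t` are isomorphic compatibly with the projections from `R`,
that is, `s` and `t` are equivalent systems of relations. -/
def SameQuotient (s t : Set R) : Prop :=
  ∃ e : QuotBy s ≃ₐ[k] QuotBy t, ∀ r : R, e (QuotBy.proj k s r) = QuotBy.proj k t r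

variable {k} in
/-- The set `{[a, b] : a, b ∈ R₁}` of commutators of elements of a subalgebra. -/
def commutators (R₁ : Subalgebra k R) : Set R :=
  {c | ∃ a ∈ R₁, ∃ b ∈ R₁, c = ⁅a, b⁆}

variable {k} in
/-- The partial abelianization `(R₁, R)^{ab}`: the quotient of `R` by the two-sided ideal generated
by `[R₁, R₁]`. -/
abbrev PartialAb (R₁ : Subalgebra k R) : Type u := QuotBy (commutators R₁)

variable (R)

/-- `mid(R)`: the supremum of the `k`-dimensions of the irreducible representations of `R`.
Every simple `R`-module is a quotient of `R`, so modules in the universe of `R` suffice. -/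
def mid : ℕ∞ :=
  ⨆ (M : Type u) (_ : AddCommGroup M) (_ : Module k M) (_ : Module R M) (_ : IsScalarTower k R M)
    (_ : IsSimpleModule R M), Cardinal.toENat (Module.rank k M)

/-- `R` has finite-dimensional irreducible representations of arbitrarily large dimension. -/
def HasLargeFiniteIrreps : Prop :=
  ∀ n : ℕ, ∃ (M : Type u) (_ : AddCommGroup M) (_ : Module k M) (_ : Module R M)
    (_ : IsScalarTower k R M) (_ : IsSimpleModule R M),
    Module.Finite k M ∧ n ≤ Module.finrank k M

end General

variable (k : Type u) [Field k]

/-- The free product `k^{⊕3} * k^{⊕3}`; the factor `A` has index `0` and `B` has index `1`. -/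
abbrev FreeProd : Type u := LinearAlgebra.FreeProduct k (fun _ : Fin 2 => Fin 3 → k)

/-- The primitive idempotents of the first factor `A`. -/
def p (i : Fin 3) : FreeProd k :=
  LinearAlgebra.FreeProduct.ι k (fun _ : Fin 2 => Fin 3 → k) 0 (Pi.single i 1)

/-- The primitive idempotents of the second factor `B`. -/
def q (j : Fin 3) : FreeProd k :=
  LinearAlgebra.FreeProduct.ι k (fun _ : Fin 2 => Fin 3 → k) 1 (Pi.single j 1)

/-- The complement of `k · 1` in `A` with basis the first two idempotents. -/
def Abar : Submodule k (FreeProd k) := Submodule.span k {p k 0, p k 1}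

/-- The complement of `k · 1` in `B` with basis the first two idempotents. -/
def Bbar : Submodule k (FreeProd k) := Submodule.span k {q k 0, q k 1}

/-- The linear map `(x_{ij}) ↦ ∑_{i,j=1,2} x_{ij} [p_i, q_j]`, onto `[Ā, B̄]`. -/
def commForm : Matrix (Fin 2) (Fin 2) k →ₗ[k] FreeProd k where
  toFun x := ∑ i : Fin 2, ∑ j : Fin 2, x i j • ⁅p k i.castSucc, q k j.castSucc⁆
  map_add' x y := by simp only [Matrix.add_apply, add_smul, Finset.sum_add_distrib]
  map_smul' c x := by
    simp only [Matrix.smul_apply, smul_eq_mul, mul_smul, Finset.smul_sum, RingHom.id_apply]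

/-- `ℙ³` with homogeneous coordinates `x_{ij}`, `i, j = 1, 2`. -/
abbrev P3 : Type u := ℙ k (Matrix (Fin 2) (Fin 2) k)

variable {k}

/-- The relation `∑ x_{ij} [p_i, q_j]`, up to scalar multiples. -/
def relationSet (x : P3 k) : Set (FreeProd k) := (x.submodule.map (commForm k) : Set (FreeProd k))

/-- The algebra `S_x`. -/
abbrev S (x : P3 k) : Type u := QuotBy (relationSet x)

/-- `V` is a two-dimensional subspace of `Ā ⊕ B̄` such that `[V, V]` is the line `x` of `[Ā, B̄]`,
that is, `f(V) = x`. -/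
def InFiber (V : Submodule k (FreeProd k)) (x : P3 k) : Prop :=
  V ≤ Abar k ⊔ Bbar k ∧ Module.finrank k V = 2 ∧
    Submodule.span k {c | ∃ a ∈ V, ∃ b ∈ V, c = ⁅a, b⁆} = x.submodule.map (commForm k)

variable (k)

/-- The quadric `x₁₁ x₂₂ = x₁₂ x₂₁`. -/
def quadric : Set (P3 k) := {x | x.rep 0 0 * x.rep 1 1 = x.rep 0 1 * x.rep 1 0}

/-- The lines `l₁, l₂, l₃`. -/
def l : Fin 3 → Set (P3 k) :=
  ![{x | x.rep 1 0 = 0 ∧ x.rep 1 1 = 0},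
    {x | x.rep 0 0 = 0 ∧ x.rep 0 1 = 0},
    {x | x.rep 0 0 = x.rep 1 0 ∧ x.rep 0 1 = x.rep 1 1}]

/-- The lines `l'₁, l'₂, l'₃`. -/
def l' : Fin 3 → Set (P3 k) :=
  ![{x | x.rep 0 1 = 0 ∧ x.rep 1 1 = 0},
    {x | x.rep 0 0 = 0 ∧ x.rep 1 0 = 0},
    {x | x.rep 0 0 = x.rep 0 1 ∧ x.rep 1 0 = x.rep 1 1}]

/-- The intersection `l_i ∩ l'_j`, which consists of the single point `pt_{ij}`. -/
def pt (i j : Fin 3) : Set (P3 k) := l k i ∩ l' k j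

end PartialAbelianization

end

/-! A point of the quadric is a rank one matrix `x i j = a i * b j`, so its relation is a single
commutator `[α, β]` with `α = a₀p₀ + a₁p₁` and `β = b₀q₀ + b₁q₁` (indices from `0`). Homomorphisms
out of `S x` are thus homomorphisms under which `α` and `β` commute (`relationSet_killed_iff`), and
everything depends on the subalgebras `k[α]` and `k[β]`. If the coefficients `a₀, a₁, 0` are
distinct, `k[α]` is all of `A` (`commute_idempotents`). If two of them coincide, `α` is affine in
the remaining idempotent `p i` (`commute_combination_iff_of_isSpecial`), and this coincidence is
exactly `x ∈ l k i` (`mem_l_iff`). The same holds for `β` and `l'`, which gives the cases of the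
theorem. The subspace `V` is spanned by `α` and `β`.

If all of `A` commutes with all of `B`, the quotient is `A ⊗ B = k⁹`. Otherwise permuting
idempotents and swapping the factors brings the relations to ones involving only commutators with `p
0`, so any representation killing `p 0` survives. It remains to find large irreducible
representations of `k² * k³`: on `W³` let the `q j` be the coordinate projections and `p 1` the map
`(w_j) ↦ (s, s, s)`, `s = ∑ V_j w_j`, where `∑ V_j = 1`. These are irreducible when the `V_j` are
injective without common invariant subspaces (`eq_bot_or_eq_top_of_invariant`). -/

noncomputable section

namespace PartialAbelianization

/-! ### Complete systems of idempotents and what commutes with their combinations -/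

section Idempotents

variable {k : Type*} [Field k] {T : Type*} [Ring T] [Algebra k T]

/-- The algebra homomorphism from a power of `k` determined by a complete system of orthogonal
idempotents. -/
def idempotentHom {I : Type*} [Fintype I] [DecidableEq I] {e : I → T}
    (he : CompleteOrthogonalIdempotents e) : (I → k) →ₐ[k] T :=
  AlgHom.ofLinearMap (∑ i, (LinearMap.proj i : (I → k) →ₗ[k] k).smulRight (e i))
    (by simp [he.complete])
    (fun f g => by
      simp [Finset.sum_mul_sum, he.mul_eq, smul_smul, mul_comm])

lemma idempotentHom_apply {I : Type*} [Fintype I] [DecidableEq I] {e : I → T}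
    (he : CompleteOrthogonalIdempotents e) (f : I → k) :
    idempotentHom he f = ∑ i, f i • e i := by
  simp [idempotentHom]

lemma idempotentHom_single {I : Type*} [Fintype I] [DecidableEq I] {e : I → T}
    (he : CompleteOrthogonalIdempotents e) (i : I) :
    idempotentHom (k := k) he (Pi.single i 1) = e i := by
  simp [idempotentHom_apply, Pi.single_apply]

lemma algHom_pi_ext {I : Type*} [Fintype I] [DecidableEq I] {f g : (I → k) →ₐ[k] T}
    (h : ∀ i, f (Pi.single i 1) = g (Pi.single i 1)) : f = g := by
  apply AlgHom.toLinearMap_injective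
  apply LinearMap.pi_ext'
  intro i
  ext
  simpa using h i

/-- Pairwise products of two commuting complete systems of orthogonal idempotents form such a
system. -/
lemma completeOrthogonalIdempotents_mul {I J : Type*} [Fintype I] [Fintype J]
    {e : I → T} {f : J → T} (he : CompleteOrthogonalIdempotents e)
    (hf : CompleteOrthogonalIdempotents f) (h : ∀ i j, Commute (e i) (f j)) :
    CompleteOrthogonalIdempotents (fun x : I × J => e x.1 * f x.2) := by
  classical
  refine ⟨OrthogonalIdempotents.iff_mul_eq.2 fun x y => ?_, ?_⟩
  · have : e x.1 * f x.2 * (e y.1 * f y.2) = (e x.1 * e y.1) * (f x.2 * f y.2) := by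
      rw [mul_assoc, ← mul_assoc (f x.2), ← (h y.1 x.2).eq, mul_assoc, mul_assoc]
    rw [this, he.mul_eq, hf.mul_eq]
    by_cases h1 : x.1 = y.1 <;> by_cases h2 : x.2 = y.2 <;> simp [h1, h2, Prod.ext_iff]
  · rw [Fintype.sum_prod_type]
    simp [← Finset.mul_sum, hf.complete, he.complete]

/-- Three orthogonal idempotents `0, P, 1 - P`. -/
lemma completeOrthogonalIdempotents_zero_pair {P : T} (hP : P * P = P) :
    CompleteOrthogonalIdempotents ![0, P, 1 - P] := by
  refine ⟨OrthogonalIdempotents.iff_mul_eq.2 fun i j => ?_, ?_⟩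
  · fin_cases i <;> fin_cases j <;> simp [mul_sub, sub_mul, hP]
  · simp [Fin.sum_univ_three]

/-- Whatever commutes with two of three complete orthogonal idempotents commutes with the third. -/
lemma commute_of_commute_pair {e : Fin 3 → T}
    (he : CompleteOrthogonalIdempotents e) {t : T} (h0 : Commute (e 0) t) (h1 : Commute (e 1) t)
    (i : Fin 3) : Commute (e i) t := by
  have h2 : e 2 = 1 - e 0 - e 1 := by
    rw [← he.complete, Fin.sum_univ_three]; abel
  fin_cases i
  · exact h0
  · exact h1
  · change Commute (e 2) t
    rw [h2]; exact ((Commute.one_left t).sub_left h0).sub_left h1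

/-- The combination of the first two members of a triple with coefficients `a`. -/
def combination (e : Fin 3 → T) (a : Fin 2 → k) : T := a 0 • e 0 + a 1 • e 1

/-- The coefficients `a 0, a 1, 0` other than the `i`-th one coincide. -/
def IsSpecial (a : Fin 2 → k) (i : Fin 3) : Prop := ![a 1 = 0, a 0 = 0, a 0 = a 1] i

lemma commute_combination {e : Fin 3 → T} {t : T} (h : ∀ i, Commute (e i) t) (a : Fin 2 → k) :
    Commute (combination e a) t :=
  ((h 0).smul_left _).add_left ((h 1).smul_left _)

/-- Commuting with a combination with two equal coefficients means commuting with the remaining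
idempotent. -/
lemma commute_combination_iff_of_isSpecial {e : Fin 3 → T}
    (he : CompleteOrthogonalIdempotents e) {a : Fin 2 → k} (ha : a ≠ 0) {i : Fin 3}
    (hi : IsSpecial a i) {t : T} : Commute (combination e a) t ↔ Commute (e i) t := by
  -- The combination is affine in `e i`; for the last index, `a₀(e₀ + e₁) = a₀ - a₀e₂`.
  obtain ⟨c, hc, d, h⟩ : ∃ c : k, c ≠ 0 ∧ ∃ d : k, combination e a = c • e i + d • 1 := by
    have ha' : ¬ (a 0 = 0 ∧ a 1 = 0) := fun h => ha (by
      ext i; fin_cases i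
      · exact h.1
      · exact h.2)
    fin_cases i
    · have hi : a 1 = 0 := hi
      exact ⟨a 0, fun h => ha' ⟨h, hi⟩, 0, by simp [combination, hi]⟩
    · have hi : a 0 = 0 := hi
      exact ⟨a 1, fun h => ha' ⟨hi, h⟩, 0, by simp [combination, hi]⟩
    · have hi : a 0 = a 1 := hi
      refine ⟨- a 0, neg_ne_zero.2 fun h => ha' ⟨h, hi ▸ h⟩, a 0, ?_⟩
      rw [← he.complete, Fin.sum_univ_three, combination, hi]
      change _ = -a 1 • e 2 + _
      module
  rw [h]
  constructor
  · intro h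
    have : e i = c⁻¹ • (c • e i + d • 1 - d • 1) := by
      rw [add_sub_cancel_right, inv_smul_smul₀ hc]
    rw [this]
    exact (h.sub_left ((Commute.one_left t).smul_left d)).smul_left _
  · exact fun h => (h.smul_left c).add_left ((Commute.one_left t).smul_left d)

/-- In a complete system of three orthogonal idempotents, whatever commutes with a combination
with distinct coefficients commutes with the whole system. -/
lemma commute_idempotents {e : Fin 3 → T} (he : CompleteOrthogonalIdempotents e) {a : Fin 2 → k}
    (h : ∀ i, ¬ IsSpecial a i) {t : T} (ht : Commute (combination e a) t)
    (i : Fin 3) : Commute (e i) t := by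
  obtain ⟨a, b, rfl⟩ : ∃ c d, a = ![c, d] := ⟨a 0, a 1, by ext i; fin_cases i <;> rfl⟩
  have hb : b ≠ 0 := h 0
  have ha : a ≠ 0 := h 1
  have hab : a ≠ b := h 2
  change Commute (a • e 0 + b • e 1) t at ht
  set α := a • e 0 + b • e 1 with hα
  have h00 := he.mul_eq 0 0
  have h01 := he.mul_eq 0 1
  have h10 := he.mul_eq 1 0
  have h11 := he.mul_eq 1 1
  simp only [if_true, Fin.isValue, zero_ne_one, one_ne_zero, if_false] at h00 h01 h10 h11
  -- Lagrange interpolation: `α² - bα` and `aα - α²` each isolate one idempotent, with factors `a(a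
  -- - b)` and `b(a - b)` that are nonzero as `a, b, 0` are distinct.
  have hsq : α * α = (a * a) • e 0 + (b * b) • e 1 := by
    simp [hα, add_mul, mul_add, h00, h01, h10, h11, smul_smul]
  have hsub : a - b ≠ 0 := sub_ne_zero.2 hab
  have h0 : e 0 = (a * (a - b))⁻¹ • (α * α - b • α) := by
    have : α * α - b • α = (a * (a - b)) • e 0 := by rw [hsq, hα]; module
    rw [this, inv_smul_smul₀ (mul_ne_zero ha hsub)]
  have h1 : e 1 = (b * (a - b))⁻¹ • (a • α - α * α) := by
    have : a • α - α * α = (b * (a - b)) • e 1 := by rw [hsq, hα]; module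
    rw [this, inv_smul_smul₀ (mul_ne_zero hb hsub)]
  have c0 : Commute (e 0) t := by
    rw [h0]; exact ((ht.mul_left ht).sub_left (ht.smul_left b)).smul_left _
  have c1 : Commute (e 1) t := by
    rw [h1]; exact ((ht.smul_left a).sub_left (ht.mul_left ht)).smul_left _
  exact commute_of_commute_pair he c0 c1 i

end Idempotents

/-! ### Quotients by relations and partial abelianization -/

section Quotients

variable {k : Type u} [Field k] {R : Type u} [Ring R] [Algebra k R]

lemma QuotBy.proj_eq_zero {s : Set R} {r : R} (hr : r ∈ s) : QuotBy.proj k s r = 0 := by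
  rw [← map_zero (QuotBy.proj k s)]
  exact RingQuot.mkAlgHom_rel k ⟨hr, rfl⟩

lemma QuotBy.proj_surjective (s : Set R) : Function.Surjective (QuotBy.proj k s) :=
  RingQuot.mkAlgHom_surjective k _

/-- A homomorphism that kills `s` factors through the quotient by `s`. -/
def QuotBy.lift {T : Type*} [Ring T] [Algebra k T] {s : Set R} (f : R →ₐ[k] T)
    (hf : ∀ r ∈ s, f r = 0) : QuotBy s →ₐ[k] T :=
  RingQuot.liftAlgHom k ⟨f, fun a b h => by rw [hf a h.1, h.2, map_zero]⟩

@[simp]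
lemma QuotBy.lift_proj {T : Type*} [Ring T] [Algebra k T] {s : Set R} (f : R →ₐ[k] T)
    (hf : ∀ r ∈ s, f r = 0) (r : R) : QuotBy.lift f hf (QuotBy.proj k s r) = f r :=
  RingQuot.liftAlgHom_mkAlgHom_apply k f _ r

/-- An automorphism that matches two systems of relations induces an isomorphism of the
quotients. -/
lemma exists_quotEquiv {s t : Set R} (φ : R ≃ₐ[k] R)
    (h : ∀ (T : Type u) [Ring T] [Algebra k T] (f : R →ₐ[k] T),
      (∀ r ∈ s, f (φ r) = 0) ↔ ∀ r ∈ t, f r = 0) :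
    ∃ e : QuotBy s ≃ₐ[k] QuotBy t, ∀ r, e (QuotBy.proj k s r) = QuotBy.proj k t (φ r) := by
  obtain ⟨F, hF⟩ : ∃ F : QuotBy s →ₐ[k] QuotBy t,
      ∀ r, F (QuotBy.proj k s r) = QuotBy.proj k t (φ r) :=
    ⟨QuotBy.lift ((QuotBy.proj k t).comp φ.toAlgHom)
      ((h _ (QuotBy.proj k t)).2 fun r hr => QuotBy.proj_eq_zero hr),
      fun r => QuotBy.lift_proj _ _ r⟩
  obtain ⟨G, hG⟩ : ∃ G : QuotBy t →ₐ[k] QuotBy s,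
      ∀ r, G (QuotBy.proj k t r) = QuotBy.proj k s (φ.symm r) :=
    ⟨QuotBy.lift ((QuotBy.proj k s).comp φ.symm.toAlgHom)
      ((h _ ((QuotBy.proj k s).comp φ.symm.toAlgHom)).1 fun r hr => by
        simpa using QuotBy.proj_eq_zero (k := k) hr),
      fun r => QuotBy.lift_proj _ _ r⟩
  refine ⟨AlgEquiv.ofAlgHom F G ?_ ?_, hF⟩
  · refine AlgHom.ext fun y => ?_
    obtain ⟨r, rfl⟩ := QuotBy.proj_surjective (k := k) t y
    rw [AlgHom.comp_apply, hG, hF, φ.apply_symm_apply, AlgHom.id_apply]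
  · refine AlgHom.ext fun y => ?_
    obtain ⟨r, rfl⟩ := QuotBy.proj_surjective (k := k) s y
    rw [AlgHom.comp_apply, hF, hG, φ.symm_apply_apply, AlgHom.id_apply]

/-- Yoneda for quotients: the two quotients are themselves among the test algebras `T`. -/
lemma sameQuotient_of_forall_algHom {s t : Set R}
    (h : ∀ (T : Type u) [Ring T] [Algebra k T] (f : R →ₐ[k] T),
      (∀ r ∈ s, f r = 0) ↔ ∀ r ∈ t, f r = 0) : SameQuotient k s t :=
  exists_quotEquiv AlgEquiv.refl h

lemma map_lie_eq_zero_iff {T : Type*} [Ring T] [Algebra k T] (f : R →ₐ[k] T) {a b : R} :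
    f ⁅a, b⁆ = 0 ↔ Commute (f a) (f b) := by
  rw [Ring.lie_def, map_sub, map_mul, map_mul, sub_eq_zero]
  rfl

/-- The partial abelianization with respect to the subalgebra generated by a subspace `V` only
depends on the span of the commutators of elements of `V`. -/
lemma sameQuotient_commutators_adjoin (V : Submodule k R) (L : Submodule k R)
    (h : Submodule.span k {c | ∃ a ∈ V, ∃ b ∈ V, c = ⁅a, b⁆} = L) :
    SameQuotient k (commutators (Algebra.adjoin k (V : Set R))) (L : Set R) := by
  refine sameQuotient_of_forall_algHom fun T _ _ f => ⟨fun hf r hr => ?_, ?_⟩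
  · rw [SetLike.mem_coe, ← h] at hr
    induction hr using Submodule.span_induction with
    | mem c hc =>
      obtain ⟨a, ha, b, hb, rfl⟩ := hc
      exact hf _ ⟨a, Algebra.subset_adjoin ha, b, Algebra.subset_adjoin hb, rfl⟩
    | zero => exact map_zero _
    | add x y _ _ hx hy => rw [map_add, hx, hy, add_zero]
    | smul c x _ hx => rw [map_smul, hx, smul_zero]
  · rintro hf _ ⟨a, ha, b, hb, rfl⟩
    rw [map_lie_eq_zero_iff]
    have hV : ∀ v ∈ V, ∀ w ∈ V, Commute (f v) (f w) := by
      intro v hv w hw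
      rw [← map_lie_eq_zero_iff]
      apply hf
      rw [SetLike.mem_coe, ← h]
      exact Submodule.subset_span ⟨v, hv, w, hw, rfl⟩
    -- Commutants are subalgebras, so commutation passes from generators to the generated algebra,
    -- one argument at a time.
    induction ha using Algebra.adjoin_induction with
    | mem v hv =>
      induction hb using Algebra.adjoin_induction with
      | mem w hw => exact hV v hv w hw
      | algebraMap c => rw [AlgHom.commutes]; exact Algebra.commute_algebraMap_right _ _
      | add x y _ _ hx hy => rw [map_add]; exact hx.add_right hy
      | mul x y _ _ hx hy => rw [map_mul]; exact hx.mul_right hy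
    | algebraMap c => rw [AlgHom.commutes]; exact Algebra.commute_algebraMap_left _ _
    | add x y _ _ hx hy => rw [map_add]; exact hx.add_left hy
    | mul x y _ _ hx hy => rw [map_mul]; exact hx.mul_left hy

end Quotients

/-! ### Simple modules and their dimensions -/

section Irreps

variable {k : Type u} [Field k] {T : Type u} [Ring T] [Algebra k T]

/-- An irreducible representation, given as a homomorphism to an endomorphism algebra, is a simple
module. -/
lemma exists_isSimpleModule_of_algHom {M : Type*} [AddCommGroup M] [Module k M] [Nontrivial M]
    (f : T →ₐ[k] Module.End k M)
    (hf : ∀ N : Submodule k M, (∀ t, ∀ m ∈ N, f t m ∈ N) → N = ⊥ ∨ N = ⊤) :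
    ∃ (_ : Module T M) (_ : IsScalarTower k T M), IsSimpleModule T M := by
  let _ : Module T M := Module.compHom M f.toRingHom
  have hsmul : ∀ (t : T) (m : M), t • m = f t m := fun _ _ => rfl
  have hst : IsScalarTower k T M := ⟨fun c t m => by
    rw [hsmul, hsmul, map_smul, LinearMap.smul_apply]⟩
  refine ⟨inferInstance, hst,
    { exists_pair_ne := ⟨⊥, ⊤, bot_ne_top⟩, eq_bot_or_eq_top := fun N => ?_ }⟩
  rcases hf (N.restrictScalars k) (fun t m hm => N.smul_mem t hm) with h | h
  · exact Or.inl ((Submodule.restrictScalars_eq_bot_iff k T M).1 h)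
  · exact Or.inr ((Submodule.restrictScalars_eq_top_iff k T M).1 h)

lemma HasLargeFiniteIrreps.mid_eq_top (h : HasLargeFiniteIrreps k T) : mid k T = ⊤ := by
  rw [ENat.eq_top_iff_forall_ge]
  intro n
  obtain ⟨M, i₁, i₂, i₃, i₄, i₅, hfin, hn⟩ := h n
  refine le_trans ?_ (le_iSup_of_le M <| le_iSup_of_le i₁ <| le_iSup_of_le i₂ <|
    le_iSup_of_le i₃ <| le_iSup_of_le i₄ <| le_iSup_of_le i₅ le_rfl)
  rw [Cardinal.natCast_le_toENat, ← Module.finrank_eq_rank]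
  exact_mod_cast hn

/-- The simple modules of a power of `k` are one-dimensional. -/
lemma mid_eq_one_of_algEquiv {I : Type*} [Fintype I] [DecidableEq I] [Nonempty I]
    (F : T ≃ₐ[k] (I → k)) : mid k T = 1 := by
  apply le_antisymm
  · refine iSup_le fun M => iSup_le fun _ => iSup_le fun _ => iSup_le fun _ => iSup_le fun _ =>
      iSup_le fun _ => ?_
    rw [Cardinal.toENat_le_one]
    have : Nontrivial M := IsSimpleModule.nontrivial T M
    obtain ⟨m, hm⟩ := exists_ne (0 : M)
    -- The primitive idempotents sum to `1`, so one of them does not kill `m`; on its image `t` acts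
    -- by the scalar `F t i`, and by simplicity this image vector generates `M`.
    obtain ⟨i, hi⟩ : ∃ i, F.symm (Pi.single i 1) • m ≠ 0 := by
      by_contra! h
      apply hm
      rw [← one_smul T m, ← map_one F.symm, ← Finset.univ_sum_single (1 : I → k), map_sum,
        Finset.sum_smul]
      exact Finset.sum_eq_zero fun i _ => h i
    refine rank_le_one_iff.2 ⟨F.symm (Pi.single i 1) • m, fun v => ?_⟩
    obtain ⟨t, rfl⟩ := IsSimpleModule.toSpanSingleton_surjective T hi v
    refine ⟨F t i, ?_⟩
    rw [LinearMap.toSpanSingleton_apply, ← mul_smul, ← smul_assoc, ← map_smul]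
    congr 1
    apply F.injective
    rw [map_mul, F.apply_symm_apply, F.apply_symm_apply]
    ext j
    by_cases hj : j = i
    · subst hj; simp
    · simp [hj]
  · obtain ⟨i⟩ := ‹Nonempty I›
    obtain ⟨i₁, i₂, i₃⟩ := exists_isSimpleModule_of_algHom (M := k)
      ((Algebra.lmul k k).comp ((Pi.evalAlgHom k (fun _ : I => k) i).comp F.toAlgHom))
      (fun N _ => eq_bot_or_eq_top N)
    refine le_trans ?_ (le_iSup_of_le k <| le_iSup_of_le inferInstance <|
      le_iSup_of_le inferInstance <|
      le_iSup_of_le i₁ <| le_iSup_of_le i₂ <| le_iSup_of_le i₃ le_rfl)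
    simp

end Irreps

/-! ### Homomorphisms, automorphisms and characters of the free product -/

section FreeProd

variable {k : Type u} [Field k] {T : Type*} [Ring T] [Algebra k T]

/-- The homomorphism from the free product given by two complete systems of orthogonal
idempotents. -/
def freeHom {e f : Fin 3 → T} (he : CompleteOrthogonalIdempotents e)
    (hf : CompleteOrthogonalIdempotents f) : FreeProd k →ₐ[k] T :=
  LinearAlgebra.FreeProduct.lift k (fun _ : Fin 2 => Fin 3 → k)
    (fun {i} => ![idempotentHom he, idempotentHom hf] i)

@[simp]
lemma freeHom_p {e f : Fin 3 → T} (he : CompleteOrthogonalIdempotents e)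
    (hf : CompleteOrthogonalIdempotents f) (i : Fin 3) :
    freeHom (k := k) he hf (p k i) = e i := by
  have := DFunLike.congr_fun (LinearAlgebra.FreeProduct.lift_comp_ι (i := 0) k
    (fun _ : Fin 2 => Fin 3 → k)
    (fun {i} => ![idempotentHom (k := k) he, idempotentHom hf] i)) (Pi.single i 1)
  exact this.trans (idempotentHom_single he i)

@[simp]
lemma freeHom_q {e f : Fin 3 → T} (he : CompleteOrthogonalIdempotents e)
    (hf : CompleteOrthogonalIdempotents f) (i : Fin 3) :
    freeHom (k := k) he hf (q k i) = f i := by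
  have := DFunLike.congr_fun (LinearAlgebra.FreeProduct.lift_comp_ι (i := 1) k
    (fun _ : Fin 2 => Fin 3 → k)
    (fun {i} => ![idempotentHom (k := k) he, idempotentHom hf] i)) (Pi.single i 1)
  exact this.trans (idempotentHom_single hf i)

lemma freeProd_hom_ext {f g : FreeProd k →ₐ[k] T} (hp : ∀ i, f (p k i) = g (p k i))
    (hq : ∀ j, f (q k j) = g (q k j)) : f = g := by
  apply (LinearAlgebra.FreeProduct.lift k (fun _ : Fin 2 => Fin 3 → k)).symm.injective
  funext i
  apply algHom_pi_ext
  intro j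
  fin_cases i
  · exact hp j
  · exact hq j

variable (k) in
lemma completeOrthogonalIdempotents_p : CompleteOrthogonalIdempotents (p k) :=
  (CompleteOrthogonalIdempotents.single (fun _ : Fin 3 => k)).map
    (LinearAlgebra.FreeProduct.ι k (fun _ : Fin 2 => Fin 3 → k) 0).toRingHom

variable (k) in
lemma completeOrthogonalIdempotents_q : CompleteOrthogonalIdempotents (q k) :=
  (CompleteOrthogonalIdempotents.single (fun _ : Fin 3 => k)).map
    (LinearAlgebra.FreeProduct.ι k (fun _ : Fin 2 => Fin 3 → k) 1).toRingHom

lemma completeOrthogonalIdempotents_map_p (f : FreeProd k →ₐ[k] T) :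
    CompleteOrthogonalIdempotents (fun i => f (p k i)) :=
  (completeOrthogonalIdempotents_p k).map f.toRingHom

lemma completeOrthogonalIdempotents_map_q (f : FreeProd k →ₐ[k] T) :
    CompleteOrthogonalIdempotents (fun j => f (q k j)) :=
  (completeOrthogonalIdempotents_q k).map f.toRingHom

variable (k) in
/-- The automorphism permuting the idempotents of both factors. -/
def permAut (σ τ : Equiv.Perm (Fin 3)) : FreeProd k ≃ₐ[k] FreeProd k :=
  AlgEquiv.ofAlgHom
    (freeHom ((CompleteOrthogonalIdempotents.equiv σ).2 (completeOrthogonalIdempotents_p k))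
      ((CompleteOrthogonalIdempotents.equiv τ).2 (completeOrthogonalIdempotents_q k)))
    (freeHom ((CompleteOrthogonalIdempotents.equiv σ.symm).2 (completeOrthogonalIdempotents_p k))
      ((CompleteOrthogonalIdempotents.equiv τ.symm).2 (completeOrthogonalIdempotents_q k)))
    (freeProd_hom_ext (by simp) (by simp)) (freeProd_hom_ext (by simp) (by simp))

lemma permAut_p (σ τ : Equiv.Perm (Fin 3)) (i : Fin 3) : permAut k σ τ (p k i) = p k (σ i) :=
  freeHom_p _ _ i

lemma permAut_q (σ τ : Equiv.Perm (Fin 3)) (i : Fin 3) : permAut k σ τ (q k i) = q k (τ i) :=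
  freeHom_q _ _ i

variable (k) in
/-- The automorphism interchanging the two factors. -/
def swapAut : FreeProd k ≃ₐ[k] FreeProd k :=
  AlgEquiv.ofAlgHom
    (freeHom (completeOrthogonalIdempotents_q k) (completeOrthogonalIdempotents_p k))
    (freeHom (completeOrthogonalIdempotents_q k) (completeOrthogonalIdempotents_p k))
    (freeProd_hom_ext (by simp) (by simp)) (freeProd_hom_ext (by simp) (by simp))

lemma swapAut_p (i : Fin 3) : swapAut k (p k i) = q k i := freeHom_p _ _ i

lemma swapAut_q (i : Fin 3) : swapAut k (q k i) = p k i := freeHom_q _ _ i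

variable (k) in
lemma completeOrthogonalIdempotents_fst :
    CompleteOrthogonalIdempotents (fun (i : Fin 3) (x : Fin 3 × Fin 3) =>
      (Pi.single i 1 : Fin 3 → k) x.1) :=
  (CompleteOrthogonalIdempotents.single (fun _ : Fin 3 => k)).map
    (RingHom.pi fun x : Fin 3 × Fin 3 => Pi.evalRingHom (fun _ : Fin 3 => k) x.1)

variable (k) in
lemma completeOrthogonalIdempotents_snd :
    CompleteOrthogonalIdempotents (fun (i : Fin 3) (x : Fin 3 × Fin 3) =>
      (Pi.single i 1 : Fin 3 → k) x.2) :=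
  (CompleteOrthogonalIdempotents.single (fun _ : Fin 3 => k)).map
    (RingHom.pi fun x : Fin 3 × Fin 3 => Pi.evalRingHom (fun _ : Fin 3 => k) x.2)

variable (k) in
/-- The nine characters of the free product. -/
def characters : FreeProd k →ₐ[k] (Fin 3 × Fin 3 → k) :=
  freeHom (completeOrthogonalIdempotents_fst k) (completeOrthogonalIdempotents_snd k)

lemma characters_p (i : Fin 3) (x : Fin 3 × Fin 3) :
    characters k (p k i) x = (Pi.single i 1 : Fin 3 → k) x.1 :=
  congrFun (freeHom_p _ _ i) x

lemma characters_q (i : Fin 3) (x : Fin 3 × Fin 3) :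
    characters k (q k i) x = (Pi.single i 1 : Fin 3 → k) x.2 :=
  congrFun (freeHom_q _ _ i) x

/-- A quotient of the free product in which the two factors commute, and on which the nine
characters are defined, is `k^{⊕9}`. -/
lemma nonempty_algEquiv_of_commute {s : Set (FreeProd k)} (hs : ∀ r ∈ s, characters k r = 0)
    (h : ∀ i j, Commute (QuotBy.proj k s (p k i)) (QuotBy.proj k s (q k j))) :
    Nonempty (QuotBy s ≃ₐ[k] (Fin 9 → k)) := by
  have he := completeOrthogonalIdempotents_map_p (QuotBy.proj k s)
  have hf := completeOrthogonalIdempotents_map_q (QuotBy.proj k s)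
  have hef := completeOrthogonalIdempotents_mul he hf h
  have hF : ∀ r, QuotBy.lift (characters k) hs (QuotBy.proj k s r) = characters k r :=
    QuotBy.lift_proj _ hs
  refine ⟨(AlgEquiv.ofAlgHom (QuotBy.lift (characters k) hs) (idempotentHom hef) ?_ ?_).trans
    (AlgEquiv.piCongrLeft' k (fun _ : Fin 3 × Fin 3 => k) finProdFinEquiv)⟩
  · apply algHom_pi_ext
    rintro ⟨i, j⟩
    rw [AlgHom.comp_apply, idempotentHom_single, map_mul, hF, hF, AlgHom.id_apply]
    ext ⟨i', j'⟩
    rw [Pi.mul_apply, characters_p, characters_q]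
    by_cases h1 : i' = i <;> by_cases h2 : j' = j <;> simp [h1, h2]
  -- Since the projection is surjective, the identity can be checked on the generators `p i`, `q j`.
  · suffices h' : ((idempotentHom hef).comp (QuotBy.lift (characters k) hs)).comp
        (QuotBy.proj k s) = QuotBy.proj k s by
      refine AlgHom.ext fun y => ?_
      obtain ⟨r, rfl⟩ := QuotBy.proj_surjective (k := k) s y
      exact DFunLike.congr_fun h' r
    apply freeProd_hom_ext
    · intro i
      rw [AlgHom.comp_apply, AlgHom.comp_apply, hF, idempotentHom_apply, Fintype.sum_prod_type]
      simp only [characters_p, ← Finset.smul_sum, ← Finset.mul_sum, hf.complete, mul_one]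
      simp [Pi.single_apply]
    · intro j
      rw [AlgHom.comp_apply, AlgHom.comp_apply, hF, idempotentHom_apply,
        Fintype.sum_prod_type_right]
      simp only [characters_q, ← Finset.smul_sum, ← Finset.sum_mul, he.complete, one_mul]
      simp [Pi.single_apply]

end FreeProd

/-! ### Irreducible representations of large finite dimension -/

section LargeIrreps

variable {k : Type u} [Field k]

section Triple

variable {W : Type*} [AddCommGroup W] [Module k W] (V : Fin 3 → Module.End k W)

/-- The endomorphism `(w_j) ↦ (s, s, s)`, `s = ∑ V_j w_j`, of `W³`. -/
def diagonalProjection : Module.End k (Fin 3 → W) :=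
  LinearMap.pi fun _ => ∑ j, V j ∘ₗ LinearMap.proj j

lemma diagonalProjection_apply (w : Fin 3 → W) (i : Fin 3) :
    diagonalProjection V w i = ∑ j, V j (w j) := by
  simp [diagonalProjection]

variable {V} in
lemma diagonalProjection_mul_self (hV : ∑ j, V j = 1) :
    diagonalProjection V * diagonalProjection V = diagonalProjection V := by
  refine LinearMap.ext fun w => funext fun i => ?_
  rw [Module.End.mul_apply, diagonalProjection_apply]
  simp only [diagonalProjection_apply]
  rw [← LinearMap.sum_apply, hV, Module.End.one_apply]

variable (k W) in
/-- The projection of `W³` onto its `j`-th summand. -/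
def coordinateProjection (j : Fin 3) : Module.End k (Fin 3 → W) :=
  LinearMap.single k (fun _ : Fin 3 => W) j ∘ₗ LinearMap.proj j

lemma coordinateProjection_apply (j : Fin 3) (w : Fin 3 → W) :
    coordinateProjection k W j w = Pi.single j (w j) := rfl

variable (k W) in
lemma completeOrthogonalIdempotents_coordinateProjection :
    CompleteOrthogonalIdempotents (coordinateProjection k W) := by
  refine ⟨OrthogonalIdempotents.iff_mul_eq.2 fun i j => ?_, ?_⟩
  · refine LinearMap.ext fun w => ?_
    rw [Module.End.mul_apply, coordinateProjection_apply, coordinateProjection_apply]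
    by_cases h : i = j
    · subst h
      simp [coordinateProjection_apply]
    · simp [h]
  · refine LinearMap.ext fun w => ?_
    rw [LinearMap.sum_apply]
    exact Finset.univ_sum_single w

/-- If the `V_j` are injective and have no common invariant subspace, then the projections of `W³`
have none. -/
lemma eq_bot_or_eq_top_of_invariant (hinj : ∀ j, Function.Injective (V j))
    (hirr : ∀ N : Submodule k W, (∀ j, ∀ w ∈ N, V j w ∈ N) → N = ⊥ ∨ N = ⊤)
    (N : Submodule k (Fin 3 → W)) (hP : ∀ w ∈ N, diagonalProjection V w ∈ N)
    (hQ : ∀ j, ∀ w ∈ N, coordinateProjection k W j w ∈ N) : N = ⊥ ∨ N = ⊤ := by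
  -- The vectors of `W` whose copies in all three summands lie in `N`.
  let N' : Submodule k W := ⨅ j, N.comap (LinearMap.single k (fun _ : Fin 3 => W) j)
  have hN' : ∀ w, w ∈ N' ↔ ∀ j, Pi.single j w ∈ N := fun w => by
    simp [N', Submodule.mem_iInf]
  -- The diagonal projection spreads `V j w` over all three summands and the coordinate projections
  -- separate the copies. Hence `N'` is invariant; if it is zero, injectivity of `V j` kills every
  -- component of `N`.
  have key : ∀ j w, Pi.single j w ∈ N → V j w ∈ N' := by
    intro j w hw
    rw [hN']
    intro i
    have := hQ i _ (hP _ hw)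
    rw [coordinateProjection_apply, diagonalProjection_apply] at this
    rwa [Finset.sum_eq_single j (fun l _ hl => by simp [hl]) (by simp), Pi.single_eq_same] at this
  rcases hirr N' (fun j w hw => key j w ((hN' w).1 hw j)) with h | h
  · left
    rw [Submodule.eq_bot_iff]
    intro w hw
    funext j
    have := key j (w j) (hQ j w hw)
    rw [h, Submodule.mem_bot] at this
    exact hinj j (this.trans (map_zero _).symm)
  · right
    rw [Submodule.eq_top_iff']
    intro w
    rw [← Finset.univ_sum_single w]
    exact Submodule.sum_mem _ fun j _ => (hN' (w j)).1 (h ▸ Submodule.mem_top) j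

end Triple

variable (k) (m : ℕ)

/-- The diagonal endomorphism with entries `1, …, m`. -/
def diagonalEnd : Module.End k (Fin m → k) :=
  LinearMap.pi fun i => ((i : ℕ) + 1 : k) • LinearMap.proj i

/-- The rank one endomorphism with all rows equal to `(1, …, m)`. -/
def rankOneEnd : Module.End k (Fin m → k) :=
  LinearMap.pi fun _ => ∑ i : Fin m, ((i : ℕ) + 1 : k) • LinearMap.proj i

/-- Three endomorphisms of `k^m` with sum `1`, without common invariant subspaces. -/
def endTriple : Fin 3 → Module.End k (Fin m → k) :=
  ![diagonalEnd k m, 1 + rankOneEnd k m, -(diagonalEnd k m + rankOneEnd k m)]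

variable {m}

lemma diagonalEnd_apply (w : Fin m → k) (i : Fin m) :
    diagonalEnd k m w i = ((i : ℕ) + 1 : k) * w i := rfl

lemma rankOneEnd_apply (w : Fin m → k) (i : Fin m) :
    rankOneEnd k m w i = ∑ i : Fin m, ((i : ℕ) + 1 : k) * w i := by
  simp [rankOneEnd]

variable (m)

lemma sum_endTriple : ∑ j, endTriple k m j = 1 := by
  simp [Fin.sum_univ_three, endTriple]
  abel

/-- An irreducible representation of dimension `3 m` that kills the first idempotent. -/
def largeRep : FreeProd k →ₐ[k] Module.End k (Fin 3 → Fin m → k) :=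
  freeHom (completeOrthogonalIdempotents_zero_pair
      (diagonalProjection_mul_self (sum_endTriple k m)))
    (completeOrthogonalIdempotents_coordinateProjection k (Fin m → k))

lemma largeRep_p_zero : largeRep k m (p k 0) = 0 := freeHom_p _ _ 0

variable [CharZero k]

/-- The rank one part sends `w` to the constant vector `τ`. A kernel vector is therefore determined
by `τ`, and substituting it into the definition of `τ` gives `(1 + ∑ (i + 1))τ = 0` in the second
case and `(m + 1)τ = 0` in the third. Characteristic zero forces `τ = 0`. -/
lemma endTriple_injective (j : Fin 3) : Function.Injective (endTriple k m j) := by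
  rw [injective_iff_map_eq_zero]
  intro w hw
  have hd : ∀ i : Fin m, ((i : ℕ) + 1 : k) ≠ 0 := fun i => Nat.cast_add_one_ne_zero _
  set τ := ∑ i : Fin m, ((i : ℕ) + 1 : k) * w i with hτ
  fin_cases j
  · have hw : diagonalEnd k m w = 0 := hw
    funext i
    have := congrFun hw i
    rw [diagonalEnd_apply] at this
    exact (mul_eq_zero.1 this).resolve_left (hd i)
  · have hw : (1 + rankOneEnd k m) w = 0 := hw
    have h1 : ∀ i, w i = - τ := fun i => by
      have := congrFun hw i
      rw [LinearMap.add_apply, Pi.add_apply, rankOneEnd_apply, Module.End.one_apply] at this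
      exact eq_neg_of_add_eq_zero_left this
    have h2 : (((∑ i : Fin m, ((i : ℕ) + 1)) + 1 : ℕ) : k) * τ = 0 := by
      have : τ = ∑ i : Fin m, ((i : ℕ) + 1 : k) * (- τ) := by
        rw [hτ]; exact Finset.sum_congr rfl fun i _ => by rw [h1 i]
      rw [← Finset.sum_mul] at this
      push_cast
      linear_combination this
    have h3 : τ = 0 := (mul_eq_zero.1 h2).resolve_left (Nat.cast_ne_zero.2 (Nat.succ_ne_zero _))
    funext i
    rw [h1 i, h3, neg_zero, Pi.zero_apply]
  · have hw : (-(diagonalEnd k m + rankOneEnd k m)) w = 0 := hw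
    have h1 : ∀ i : Fin m, ((i : ℕ) + 1 : k) * w i = - τ := fun i => by
      have := congrFun hw i
      rw [LinearMap.neg_apply, LinearMap.add_apply, Pi.neg_apply, Pi.add_apply, rankOneEnd_apply,
        diagonalEnd_apply, Pi.zero_apply, neg_eq_zero] at this
      exact eq_neg_of_add_eq_zero_left this
    have h2 : ((m + 1 : ℕ) : k) * τ = 0 := by
      have : τ = ∑ i : Fin m, (- τ) := by
        rw [hτ]; exact Finset.sum_congr rfl fun i _ => h1 i
      rw [Finset.sum_const, Finset.card_univ, Fintype.card_fin, nsmul_eq_mul] at this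
      push_cast
      linear_combination this
    have h3 : τ = 0 := (mul_eq_zero.1 h2).resolve_left (Nat.cast_ne_zero.2 (Nat.succ_ne_zero _))
    funext i
    have := h1 i
    rw [h3, neg_zero] at this
    exact (mul_eq_zero.1 this).resolve_left (hd i)

/-- A subspace invariant under the diagonal endomorphism with entries `1, …, m` is a coordinate
subspace. -/
lemma single_mem_of_diagonalEnd_invariant {N : Submodule k (Fin m → k)}
    (hN : ∀ w ∈ N, diagonalEnd k m w ∈ N) {w : Fin m → k} (hw : w ∈ N) {i : Fin m}
    (hi : w i ≠ 0) : Pi.single i 1 ∈ N := by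
  -- Apply `∏ (D - (l + 1))` over `l ∈ s` to `w`, where `D` is the diagonal endomorphism. Taking all
  -- `l ≠ i` leaves only the `i`-th coordinate, with nonzero factor because the eigenvalues are
  -- distinct in characteristic zero.
  have key : ∀ s : Finset (Fin m),
      (fun j : Fin m => (∏ l ∈ s, ((j : ℕ) - (l : ℕ) : k)) * w j) ∈ N := by
    intro s
    induction s using Finset.induction_on with
    | empty => simpa using hw
    | insert l s hl ih =>
      have := N.sub_mem (hN _ ih) (N.smul_mem ((l : ℕ) + 1 : k) ih)
      convert this using 1
      funext j
      rw [Finset.prod_insert hl, Pi.sub_apply, diagonalEnd_apply, Pi.smul_apply, smul_eq_mul]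
      ring
  have hc : (∏ l ∈ Finset.univ.erase i, ((i : ℕ) - (l : ℕ) : k)) * w i ≠ 0 := by
    refine mul_ne_zero (Finset.prod_ne_zero_iff.2 fun l hl => ?_) hi
    rw [sub_ne_zero, Nat.cast_injective.ne_iff, Fin.val_injective.ne_iff]
    exact (Finset.ne_of_mem_erase hl).symm
  have := N.smul_mem ((∏ l ∈ Finset.univ.erase i, ((i : ℕ) - (l : ℕ) : k)) * w i)⁻¹
    (key (Finset.univ.erase i))
  convert this using 1
  funext j
  rw [Pi.smul_apply, smul_eq_mul]
  by_cases hj : j = i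
  · subst hj
    rw [Pi.single_eq_same, inv_mul_cancel₀ hc]
  · have hz : ∏ l ∈ Finset.univ.erase i, ((j : ℕ) - (l : ℕ) : k) = 0 :=
      Finset.prod_eq_zero (Finset.mem_erase.2 ⟨hj, Finset.mem_univ j⟩) (sub_self _)
    rw [Pi.single_eq_of_ne hj, hz, zero_mul, mul_zero]

/-- A nonzero invariant subspace contains some basis vector. The rank one map turns it into a
constant vector with nonzero entries, whose coordinates then yield every basis vector. -/
lemma endTriple_irreducible (N : Submodule k (Fin m → k))
    (hN : ∀ j, ∀ w ∈ N, endTriple k m j w ∈ N) : N = ⊥ ∨ N = ⊤ := by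
  refine or_iff_not_imp_left.2 fun h => ?_
  obtain ⟨w, hw, hw0⟩ := (Submodule.ne_bot_iff _).1 h
  obtain ⟨i, hi⟩ := Function.ne_iff.1 hw0
  have hD : ∀ w ∈ N, diagonalEnd k m w ∈ N := hN 0
  have hT : ∀ w ∈ N, rankOneEnd k m w ∈ N := fun w hw => by
    have : (1 + rankOneEnd k m) w ∈ N := hN 1 w hw
    simpa using N.sub_mem this hw
  have hmem := hT _ (single_mem_of_diagonalEnd_invariant k m hD hw hi)
  rw [Submodule.eq_top_iff']
  intro v
  rw [pi_eq_sum_univ' v]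
  refine Submodule.sum_mem _ fun j _ => N.smul_mem _ ?_
  have := single_mem_of_diagonalEnd_invariant k m hD hmem (i := j) (by
    rw [rankOneEnd_apply, Finset.sum_eq_single i (fun l _ hl => by simp [hl]) (by simp)]
    simpa using Nat.cast_add_one_ne_zero (R := k) (i : ℕ))
  convert this using 1

lemma largeRep_irreducible (N : Submodule k (Fin 3 → Fin m → k))
    (hN : ∀ r, ∀ w ∈ N, largeRep k m r w ∈ N) : N = ⊥ ∨ N = ⊤ := by
  refine eq_bot_or_eq_top_of_invariant (endTriple k m) (endTriple_injective k m)
    (endTriple_irreducible k m) N (fun w hw => ?_) (fun j w hw => ?_)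
  · have h : largeRep k m (p k 1) = diagonalProjection (endTriple k m) := freeHom_p _ _ 1
    exact h ▸ hN (p k 1) w hw
  · have h : largeRep k m (q k j) = coordinateProjection k (Fin m → k) j := freeHom_q _ _ j
    exact h ▸ hN (q k j) w hw

variable {k}

lemma hasLargeFiniteIrreps_of_algEquiv {T : Type u} [Ring T] [Algebra k T]
    {s : Set (FreeProd k)} (hs : ∀ m, ∀ r ∈ s, largeRep k m r = 0) (e : T ≃ₐ[k] QuotBy s) :
    HasLargeFiniteIrreps k T := by
  intro n
  -- The size `n + 1` rather than `n` keeps the space nonzero; its dimension is `3(n + 1)`.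
  obtain ⟨i₁, i₂, i₃⟩ := exists_isSimpleModule_of_algHom
    ((QuotBy.lift (largeRep k (n + 1)) (hs _)).comp e.toAlgHom) (fun N hN => by
      refine largeRep_irreducible k (n + 1) N fun r w hw => ?_
      have h : (QuotBy.lift (largeRep k (n + 1)) (hs _)).comp e.toAlgHom
          (e.symm (QuotBy.proj k s r)) = largeRep k (n + 1) r :=
        (congrArg _ (e.apply_symm_apply _)).trans (QuotBy.lift_proj _ _ r)
      exact h ▸ hN (e.symm (QuotBy.proj k s r)) w hw)
  refine ⟨Fin 3 → Fin (n + 1) → k, inferInstance, inferInstance, i₁, i₂, i₃, inferInstance, ?_⟩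
  rw [Module.finrank_pi_fintype]
  simp
  omega

end LargeIrreps

/-! ### Rank one relations and the stratification of the quadric -/

section Quadric

variable {k : Type u} [Field k]

/-- A nonzero `2 × 2` matrix of determinant zero has rank one. -/
lemma exists_mul_eq_of_mem_quadric {x : P3 k} (hx : x ∈ quadric k) :
    ∃ a b : Fin 2 → k, a ≠ 0 ∧ b ≠ 0 ∧ ∀ i j, x.rep i j = a i * b j := by
  have hdet : x.rep 0 0 * x.rep 1 1 = x.rep 0 1 * x.rep 1 0 := hx
  obtain ⟨i₀, j₀, h⟩ : ∃ i j, x.rep i j ≠ 0 := by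
    by_contra! h
    exact x.rep_nonzero (Matrix.ext h)
  -- Vanishing of the minors through the pivot `(i₀, j₀)`: the pivot column and the rescaled pivot
  -- row are the two factors.
  have hmul : ∀ i j, x.rep i j * x.rep i₀ j₀ = x.rep i j₀ * x.rep i₀ j := by
    intro i j
    fin_cases i <;> fin_cases j <;> fin_cases i₀ <;> fin_cases j₀ <;>
      simp only [Fin.zero_eta, Fin.mk_one] <;> first | ring1 | linear_combination hdet |
        linear_combination -hdet
  refine ⟨fun i => x.rep i j₀, fun j => x.rep i₀ j / x.rep i₀ j₀, fun h0 => h (congrFun h0 i₀),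
    fun h0 => ?_, fun i j => ?_⟩
  · have := congrFun h0 j₀
    simp [h] at this
  · rw [mul_div_assoc', eq_div_iff h, hmul]

variable {x : P3 k} {a b : Fin 2 → k}

lemma commForm_rep (h : ∀ i j, x.rep i j = a i * b j) :
    commForm k x.rep = ⁅combination (p k) a, combination (q k) b⁆ := by
  change ∑ i : Fin 2, ∑ j : Fin 2, x.rep i j • ⁅p k i.castSucc, q k j.castSucc⁆ = _
  simp only [Fin.sum_univ_two, h, combination, Ring.lie_def, mul_add, add_mul,
    smul_mul_assoc, mul_smul_comm, Fin.castSucc_zero, Fin.castSucc_one]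
  module

lemma map_submodule_eq_span (h : ∀ i j, x.rep i j = a i * b j) :
    x.submodule.map (commForm k) = k ∙ ⁅combination (p k) a, combination (q k) b⁆ := by
  rw [x.submodule_eq, Submodule.map_span, Set.image_singleton, commForm_rep h]

/-- Reduces every stratum to a question about which elements commute in an arbitrary target. -/
lemma relationSet_killed_iff (h : ∀ i j, x.rep i j = a i * b j) {T : Type*} [Ring T]
    [Algebra k T] (f : FreeProd k →ₐ[k] T) :
    (∀ r ∈ relationSet x, f r = 0) ↔
      Commute (combination (fun i => f (p k i)) a) (combination (fun j => f (q k j)) b) := by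
  have h1 : ∀ (e : Fin 3 → FreeProd k) (c : Fin 2 → k),
      combination (fun i => f (e i)) c = f (combination e c) := fun e c => by
    simp [combination]
  rw [h1, h1, ← map_lie_eq_zero_iff]
  simp only [relationSet, map_submodule_eq_span h, SetLike.mem_coe]
  refine ⟨fun hf => hf _ (Submodule.mem_span_singleton_self _), fun hf r hr => ?_⟩
  obtain ⟨c, rfl⟩ := Submodule.mem_span_singleton.1 hr
  rw [map_smul, hf, smul_zero]

lemma linearIndependent_combinations (ha : a ≠ 0) (hb : b ≠ 0) :
    LinearIndependent k ![combination (p k) a, combination (q k) b] := by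
  rw [LinearIndependent.pair_iff]
  intro s t hst
  have hval : ∀ x : Fin 3 × Fin 3, s * (a 0 * (Pi.single 0 1 : Fin 3 → k) x.1 +
      a 1 * (Pi.single 1 1 : Fin 3 → k) x.1) + t * (b 0 * (Pi.single 0 1 : Fin 3 → k) x.2 +
      b 1 * (Pi.single 1 1 : Fin 3 → k) x.2) = 0 := fun x => by
    have := congrFun (congrArg (characters k) hst) x
    simpa [combination, characters_p, characters_q, mul_add] using this
  obtain ⟨i, hi⟩ := Function.ne_iff.1 ha
  obtain ⟨j, hj⟩ := Function.ne_iff.1 hb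
  have hi' : s * a i = 0 := by
    -- At this character `q 0` and `q 1` vanish, leaving only `s * a i`.
    have := hval (i.castSucc, 2)
    fin_cases i <;> simpa [Pi.single_apply] using this
  have hj' : t * b j = 0 := by
    have := hval (2, j.castSucc)
    fin_cases j <;> simpa [Pi.single_apply] using this
  exact ⟨(mul_eq_zero.1 hi').resolve_right hi, (mul_eq_zero.1 hj').resolve_right hj⟩

lemma span_commutators_span_pair {R : Type*} [Ring R] [Algebra k R] (u v : R) :
    Submodule.span k {c | ∃ a ∈ Submodule.span k {u, v}, ∃ b ∈ Submodule.span k {u, v},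
      c = ⁅a, b⁆} = k ∙ ⁅u, v⁆ := by
  apply le_antisymm
  · rw [Submodule.span_le]
    rintro _ ⟨y, hy, z, hz, rfl⟩
    obtain ⟨c, d, rfl⟩ := Submodule.mem_span_pair.1 hy
    obtain ⟨c', d', rfl⟩ := Submodule.mem_span_pair.1 hz
    refine Submodule.mem_span_singleton.2 ⟨c * d' - d * c', ?_⟩
    simp only [Ring.lie_def, mul_add, add_mul, smul_mul_assoc, mul_smul_comm]
    module
  · rw [Submodule.span_singleton_le_iff_mem]
    exact Submodule.subset_span ⟨u, Submodule.subset_span (by simp), v,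
      Submodule.subset_span (by simp), rfl⟩

lemma exists_inFiber (ha : a ≠ 0) (hb : b ≠ 0) (h : ∀ i j, x.rep i j = a i * b j) :
    ∃ V, InFiber V x := by
  refine ⟨Submodule.span k {combination (p k) a, combination (q k) b}, ?_, ?_, ?_⟩
  · rw [Submodule.span_le]
    have hmem : ∀ (e : Fin 3 → FreeProd k) (c : Fin 2 → k),
        combination e c ∈ Submodule.span k {e 0, e 1} := fun e c =>
      Submodule.mem_span_pair.2 ⟨c 0, c 1, rfl⟩
    rintro _ (rfl | rfl)
    · exact Submodule.mem_sup_left (hmem (p k) a)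
    · exact Submodule.mem_sup_right (hmem (q k) b)
  · have := finrank_span_eq_card (linearIndependent_combinations (k := k) ha hb)
    rwa [Matrix.range_cons, Matrix.range_cons, Matrix.range_empty, Set.union_empty,
      Fintype.card_fin] at this
  · rw [span_commutators_span_pair, map_submodule_eq_span h]

lemma mem_l_iff (hb : b ≠ 0) (h : ∀ i j, x.rep i j = a i * b j) (i : Fin 3) :
    x ∈ l k i ↔ IsSpecial a i := by
  have hb' : b 0 ≠ 0 ∨ b 1 ≠ 0 := by
    by_contra! h0
    exact hb (by ext i; fin_cases i; exacts [h0.1, h0.2])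
  fin_cases i
  · change x.rep 1 0 = 0 ∧ x.rep 1 1 = 0 ↔ a 1 = 0
    simp only [h, mul_eq_zero]; tauto
  · change x.rep 0 0 = 0 ∧ x.rep 0 1 = 0 ↔ a 0 = 0
    simp only [h, mul_eq_zero]; tauto
  · change x.rep 0 0 = x.rep 1 0 ∧ x.rep 0 1 = x.rep 1 1 ↔ a 0 = a 1
    simp only [h, mul_eq_mul_right_iff]; tauto

lemma mem_l'_iff (ha : a ≠ 0) (h : ∀ i j, x.rep i j = a i * b j) (j : Fin 3) :
    x ∈ l' k j ↔ IsSpecial b j := by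
  have ha' : a 0 ≠ 0 ∨ a 1 ≠ 0 := by
    by_contra! h0
    exact ha (by ext i; fin_cases i; exacts [h0.1, h0.2])
  fin_cases j
  · change x.rep 0 1 = 0 ∧ x.rep 1 1 = 0 ↔ b 1 = 0
    simp only [h, mul_eq_zero]; tauto
  · change x.rep 0 0 = 0 ∧ x.rep 1 0 = 0 ↔ b 0 = 0
    simp only [h, mul_eq_zero]; tauto
  · change x.rep 0 0 = x.rep 0 1 ∧ x.rep 1 0 = x.rep 1 1 ↔ b 0 = b 1
    simp only [h, mul_eq_mul_left_iff]; tauto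

/-- The relations saying that `p_i` commutes with `B`. -/
abbrev rowRelations (k : Type u) [Field k] (i : Fin 3) : Set (FreeProd k) :=
  {⁅p k i, q k 0⁆, ⁅p k i, q k 1⁆}

/-- The relations saying that `q_j` commutes with `A`. -/
abbrev columnRelations (k : Type u) [Field k] (j : Fin 3) : Set (FreeProd k) :=
  {⁅p k 0, q k j⁆, ⁅p k 1, q k j⁆}

variable {T : Type*} [Ring T] [Algebra k T] (f : FreeProd k →ₐ[k] T)

lemma rowRelations_killed_iff (i : Fin 3) :
    (∀ r ∈ rowRelations k i, f r = 0) ↔ ∀ j, Commute (f (p k i)) (f (q k j)) := by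
  simp only [Set.mem_insert_iff, Set.mem_singleton_iff, forall_eq_or_imp, forall_eq,
    map_lie_eq_zero_iff]
  exact ⟨fun h j => (commute_of_commute_pair (completeOrthogonalIdempotents_map_q f)
    h.1.symm h.2.symm j).symm, fun h => ⟨h 0, h 1⟩⟩

lemma columnRelations_killed_iff (j : Fin 3) :
    (∀ r ∈ columnRelations k j, f r = 0) ↔ ∀ i, Commute (f (p k i)) (f (q k j)) := by
  simp only [Set.mem_insert_iff, Set.mem_singleton_iff, forall_eq_or_imp, forall_eq,
    map_lie_eq_zero_iff]
  exact ⟨fun h j => commute_of_commute_pair (completeOrthogonalIdempotents_map_p f) h.1 h.2 j,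
    fun h => ⟨h 0, h 1⟩⟩

/-- Permuting the idempotents within each factor is an automorphism of the free product. -/
lemma nonempty_quotEquiv_point (i j i₀ j₀ : Fin 3) :
    Nonempty (QuotBy {⁅p k i, q k j⁆} ≃ₐ[k] QuotBy {⁅p k i₀, q k j₀⁆}) := by
  obtain ⟨e, -⟩ := exists_quotEquiv (s := {⁅p k i, q k j⁆}) (t := {⁅p k i₀, q k j₀⁆})
    (permAut k (Equiv.swap i i₀) (Equiv.swap j j₀)) (fun T _ _ f => by
      simp only [Set.mem_singleton_iff, forall_eq]
      have := map_lie_eq_zero_iff (f.comp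
        (permAut k (Equiv.swap i i₀) (Equiv.swap j j₀)).toAlgHom) (a := p k i) (b := q k j)
      refine this.trans ?_
      rw [map_lie_eq_zero_iff]
      simp [permAut_p, permAut_q])
  exact ⟨e⟩

lemma nonempty_quotEquiv_row (i i₀ : Fin 3) :
    Nonempty (QuotBy (rowRelations k i) ≃ₐ[k] QuotBy (rowRelations k i₀)) := by
  obtain ⟨e, -⟩ := exists_quotEquiv (s := rowRelations k i) (t := rowRelations k i₀)
    (permAut k (Equiv.swap i i₀) 1) (fun T _ _ f => by
      refine (rowRelations_killed_iff (f.comp (permAut k (Equiv.swap i i₀) 1).toAlgHom) i).trans ?_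
      rw [rowRelations_killed_iff]
      simp [permAut_p, permAut_q])
  exact ⟨e⟩

lemma nonempty_quotEquiv_row_column (i : Fin 3) :
    Nonempty (QuotBy (rowRelations k i) ≃ₐ[k] QuotBy (columnRelations k i)) := by
  obtain ⟨e, -⟩ := exists_quotEquiv (s := rowRelations k i) (t := columnRelations k i)
    (swapAut k) (fun T _ _ f => by
      refine (rowRelations_killed_iff (f.comp (swapAut k).toAlgHom) i).trans ?_
      rw [columnRelations_killed_iff]
      simp only [AlgHom.comp_apply, AlgEquiv.toAlgHom_apply, swapAut_p, swapAut_q]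
      exact forall_congr' fun _ => Commute.symm_iff)
  exact ⟨e⟩

lemma sameQuotient_point (ha : a ≠ 0) (hb : b ≠ 0) (h : ∀ i j, x.rep i j = a i * b j)
    {i j : Fin 3} (hi : IsSpecial a i) (hj : IsSpecial b j) :
    SameQuotient k (relationSet x) {⁅p k i, q k j⁆} := by
  refine sameQuotient_of_forall_algHom fun T _ _ f => ?_
  rw [relationSet_killed_iff h, commute_combination_iff_of_isSpecial
    (completeOrthogonalIdempotents_map_p f) ha hi, Commute.symm_iff,
    commute_combination_iff_of_isSpecial (completeOrthogonalIdempotents_map_q f) hb hj,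
    Commute.symm_iff, ← map_lie_eq_zero_iff]
  simp

lemma sameQuotient_row (ha : a ≠ 0) (h : ∀ i j, x.rep i j = a i * b j)
    {i : Fin 3} (hi : IsSpecial a i) (hb : ∀ j, ¬ IsSpecial b j) :
    SameQuotient k (relationSet x) (rowRelations k i) := by
  refine sameQuotient_of_forall_algHom fun T _ _ f => ?_
  rw [relationSet_killed_iff h, commute_combination_iff_of_isSpecial
    (completeOrthogonalIdempotents_map_p f) ha hi, rowRelations_killed_iff]
  exact ⟨fun hc j => (commute_idempotents (completeOrthogonalIdempotents_map_q f) hb hc.symm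
    j).symm, fun hc => (commute_combination (fun j => (hc j).symm) b).symm⟩

lemma sameQuotient_column (hb : b ≠ 0) (h : ∀ i j, x.rep i j = a i * b j)
    {j : Fin 3} (hj : IsSpecial b j) (ha : ∀ i, ¬ IsSpecial a i) :
    SameQuotient k (relationSet x) (columnRelations k j) := by
  refine sameQuotient_of_forall_algHom fun T _ _ f => ?_
  rw [relationSet_killed_iff h, Commute.symm_iff, commute_combination_iff_of_isSpecial
    (completeOrthogonalIdempotents_map_q f) hb hj, columnRelations_killed_iff, Commute.symm_iff]
  exact ⟨fun hc i => commute_idempotents (completeOrthogonalIdempotents_map_p f) ha hc i,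
    fun hc => commute_combination hc a⟩

lemma nonempty_algEquiv_generic (h : ∀ i j, x.rep i j = a i * b j)
    (ha : ∀ i, ¬ IsSpecial a i) (hb : ∀ j, ¬ IsSpecial b j) :
    Nonempty (S x ≃ₐ[k] (Fin 9 → k)) := by
  apply nonempty_algEquiv_of_commute
  · rw [relationSet_killed_iff h]
    exact Commute.all _ _
  · intro i j
    have hc := (relationSet_killed_iff h (QuotBy.proj k (relationSet x))).1
      fun r hr => QuotBy.proj_eq_zero hr
    exact (commute_idempotents (completeOrthogonalIdempotents_map_q _) hb
      (commute_idempotents (completeOrthogonalIdempotents_map_p _) ha hc i).symm j).symm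

end Quadric

end PartialAbelianization

end

/-! ### The main theorem -/

open PartialAbelianization in
theorem mainTheorem8 {k : Type*} [Field k] [IsAlgClosed k] [CharZero k]
    (x : P3 k) (hx : x ∈ quadric k) :
    -- `S_x` is the partial abelianization `(V, R)^{ab}` for every `V` with `f(V) = x`
    ((∃ V, InFiber V x) ∧
      ∀ V, InFiber V x →
        ∃ e : PartialAb (Algebra.adjoin k (V : Set (FreeProd k))) ≃ₐ[k] S x,
          ∀ r, e (QuotBy.proj k _ r) = QuotBy.proj k _ r) ∧
    -- the points `pt_{ij}`
    (∀ i j, x ∈ pt k i j →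
      SameQuotient k (relationSet x) {⁅p k i, q k j⁆} ∧
      (∀ i₀ j₀, Nonempty (S x ≃ₐ[k] QuotBy {⁅p k i₀, q k j₀⁆})) ∧
      mid k (S x) = ⊤ ∧ HasLargeFiniteIrreps k (S x)) ∧
    -- the lines without these points
    (x ∈ (⋃ i, l k i ∪ l' k i) \ (⋃ i, ⋃ j, pt k i j) →
      (∀ i, x ∈ l k i → SameQuotient k (relationSet x) {⁅p k i, q k 0⁆, ⁅p k i, q k 1⁆}) ∧
      (∀ j, x ∈ l' k j → SameQuotient k (relationSet x) {⁅p k 0, q k j⁆, ⁅p k 1, q k j⁆}) ∧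
      (∀ i₀, Nonempty (S x ≃ₐ[k] QuotBy {⁅p k i₀, q k 0⁆, ⁅p k i₀, q k 1⁆})) ∧
      (∀ j₀, Nonempty (S x ≃ₐ[k] QuotBy {⁅p k 0, q k j₀⁆, ⁅p k 1, q k j₀⁆})) ∧
      mid k (S x) = ⊤ ∧ HasLargeFiniteIrreps k (S x)) ∧
    -- the rest of the quadric
    (x ∈ quadric k \ (⋃ i, l k i ∪ l' k i) →
      Nonempty (S x ≃ₐ[k] (Fin 9 → k)) ∧ mid k (S x) = 1) := by
  obtain ⟨a, b, ha, hb, h⟩ := exists_mul_eq_of_mem_quadric hx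
  refine ⟨⟨exists_inFiber ha hb h, fun V hV => ?_⟩, fun i j hij => ?_, fun hline => ?_,
    fun hgen => ?_⟩
  · exact sameQuotient_commutators_adjoin V _ hV.2.2
  · have hi := (mem_l_iff hb h i).1 hij.1
    have hj := (mem_l'_iff ha h j).1 hij.2
    have hsame := sameQuotient_point ha hb h hi hj
    obtain ⟨e, he⟩ := hsame
    have hequiv : ∀ i₀ j₀, Nonempty (S x ≃ₐ[k] QuotBy {⁅p k i₀, q k j₀⁆}) := fun i₀ j₀ =>
      (nonempty_quotEquiv_point i j i₀ j₀).map e.trans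
    -- The first index is `0` because `largeRep` kills `p k 0`.
    obtain ⟨e₀⟩ := hequiv 0 0
    have hlarge : HasLargeFiniteIrreps k (S x) := hasLargeFiniteIrreps_of_algEquiv (fun m r hr => by
      rw [Set.mem_singleton_iff.1 hr, map_lie_eq_zero_iff, largeRep_p_zero]
      exact Commute.zero_left _) e₀
    exact ⟨⟨e, he⟩, hequiv, hlarge.mid_eq_top, hlarge⟩
  · obtain ⟨hmem, hpt⟩ := hline
    -- Off the nine points at most one of `a`, `b` is special, so the other combination generates
    -- its whole factor.
    have hpt' : ∀ i j, ¬ (IsSpecial a i ∧ IsSpecial b j) := fun i j hij =>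
      hpt (Set.mem_iUnion₂.2 ⟨i, j, (mem_l_iff hb h i).2 hij.1, (mem_l'_iff ha h j).2 hij.2⟩)
    have hrow : ∀ i, x ∈ l k i → SameQuotient k (relationSet x) (rowRelations k i) :=
      fun i hi => sameQuotient_row ha h ((mem_l_iff hb h i).1 hi)
        fun j hj => hpt' i j ⟨(mem_l_iff hb h i).1 hi, hj⟩
    have hcol : ∀ j, x ∈ l' k j → SameQuotient k (relationSet x) (columnRelations k j) :=
      fun j hj => sameQuotient_column hb h ((mem_l'_iff ha h j).1 hj)
        fun i hi => hpt' i j ⟨hi, (mem_l'_iff ha h j).1 hj⟩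
    obtain ⟨e₀⟩ : Nonempty (S x ≃ₐ[k] QuotBy (rowRelations k 0)) := by
      obtain ⟨i, hi | hi⟩ := Set.mem_iUnion.1 hmem
      · obtain ⟨e, -⟩ := hrow i hi
        exact (nonempty_quotEquiv_row i 0).map e.trans
      · obtain ⟨e, -⟩ := hcol i hi
        obtain ⟨e'⟩ := nonempty_quotEquiv_row_column (k := k) i
        exact (nonempty_quotEquiv_row i 0).map (e.trans e'.symm).trans
    have hlarge : HasLargeFiniteIrreps k (S x) := hasLargeFiniteIrreps_of_algEquiv
      (fun m => (rowRelations_killed_iff (largeRep k m) 0).2 fun j => by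
        rw [largeRep_p_zero]
        exact Commute.zero_left _) e₀
    refine ⟨hrow, hcol, fun i₀ => (nonempty_quotEquiv_row 0 i₀).map e₀.trans, fun j₀ => ?_,
      hlarge.mid_eq_top, hlarge⟩
    obtain ⟨e₁⟩ := nonempty_quotEquiv_row (k := k) 0 j₀
    exact (nonempty_quotEquiv_row_column j₀).map (e₀.trans e₁).trans
  · have hl : ∀ i, ¬ (x ∈ l k i ∨ x ∈ l' k i) := fun i hi => hgen.2 (Set.mem_iUnion.2 ⟨i, hi⟩)
    obtain ⟨e⟩ := nonempty_algEquiv_generic h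
      (fun i hi => hl i (Or.inl ((mem_l_iff hb h i).2 hi)))
      (fun j hj => hl j (Or.inr ((mem_l'_iff ha h j).2 hj)))
    exact ⟨⟨e⟩, mid_eq_one_of_algEquiv e⟩
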